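/- There is an absolute constant $n_0$ such that the following holds for every $n \ge n_0$. Let $d$ be a real number (which may depend on $n$) with $12 \le d \le \sqrt{n}$, and let $G=(V,E)$ be a finite simple graph on $n$ vertices. For $S\subseteq V$ let $N(S)=\{v\in V\setminus S : v \text{ is adjacent to some } u\in S\}$ denote its external neighborhood, and let $\log$ be the natural logarithm. Suppose that (P1') for every $S\subseteq V$ with $|S|\le \frac{n\log d}{d\log n}$ we have $|N(S)|\ge d\,|S|$; and (P2') there is an edge of $G$ between any two disjoint sets $A,B\subseteq V$ with $|A|,|B|\ge \frac{n\log d}{1035\log n}$. Then $G$ is Hamiltonian, i.e. it contains a cycle passing through all its vertices. -/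

import Mathlib

open Classical in
/-- The external neighborhood of `S`: the vertices outside `S` that have a neighbor in `S`. -/
noncomputable def externalNeighborhood {V : Type*} [Fintype V] (G : SimpleGraph V)
    (S : Finset V) : Finset V :=
  Finset.univ.filter (fun v => v ∉ S ∧ ∃ u ∈ S, G.Adj u v)

/-- Every set `S` of at most `n log d / (d log n)` vertices, where `n` is the number of vertices
of `G`, has at least `d |S|` external neighbors. -/
def SmallSetsExpand {V : Type*} [Fintype V] (G : SimpleGraph V) (d : ℝ) : Prop :=
  ∀ S : Finset V,
    (S.card : ℝ) ≤ (Fintype.card V : ℝ) * Real.log d / (d * Real.log (Fintype.card V : ℝ)) →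
      d * (S.card : ℝ) ≤ ((externalNeighborhood G S).card : ℝ)

/-- Any two disjoint sets of at least `n log d / (1035 log n)` vertices each, where `n` is the
number of vertices of `G`, are joined by an edge. -/
def LargeSetsJoined {V : Type*} [Fintype V] (G : SimpleGraph V) (d : ℝ) : Prop :=
  ∀ A B : Finset V, Disjoint A B →
    (Fintype.card V : ℝ) * Real.log d / (1035 * Real.log (Fintype.card V : ℝ)) ≤ (A.card : ℝ) →
    (Fintype.card V : ℝ) * Real.log d / (1035 * Real.log (Fintype.card V : ℝ)) ≤ (B.card : ℝ) →
      ∃ a ∈ A, ∃ b ∈ B, G.Adj a b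

/-! The proof rotates a longest path in the manner of Pósa. Let `M` be the least integer size to
which (P2') applies. All neighbors of a first vertex lie on a longest path, so Pósa's lemma
(`card_externalNeighborhood_le`) turns external neighbors of the ends reached by `t` rotations into
about a third as many ends after `t + 1`. By (P1') the ends multiply by at least `√d` per rotation,
so about `2 log n / log d` rotations give `M` of them; by (P2') one more gives nearly a quarter of
all vertices.

So few rotations destroy few blocks of the path. Take `2 (t + 1) + 2` disjoint blocks of length `11
M + 3`, each with a part in which small sets expand (`exists_expanding_part`). For each block fewer
than `M` vertices have no neighbor in its interior, hence both ends of the path can be chosen to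
have neighbors in every interior, and two blocks survive the rotations at both ends.

Cut the path between these two blocks. Rotating each half inside its own block yields more than `M`
outer ends (`exists_many_ends`) and fixes the edge at the cut, so an edge between the two sets of
ends closes a cycle. Fewer than `M` vertices can be missed; if any is, expansion gives an edge
leaving the cycle, and opening the cycle there contradicts maximality. -/

/-! ### Adjacency and blocks in lists without repetitions -/

section ListAdjacency

variable {α : Type*}

/-- `x` and `y` occupy consecutive positions of `l`, in one of the two orders. -/
def List.Consecutive (l : List α) (x y : α) : Prop := [x, y] <:+: l ∨ [y, x] <:+: l

lemma List.Consecutive.symm {l : List α} {x y : α} (h : l.Consecutive x y) :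
    l.Consecutive y x := Or.symm h

lemma List.Consecutive.of_infix {l l' : List α} {x y : α} (h : l.Consecutive x y)
    (hl : l <:+: l') : l'.Consecutive x y :=
  h.imp (fun h => h.trans hl) (fun h => h.trans hl)

lemma List.consecutive_reverse {l : List α} {x y : α} :
    l.reverse.Consecutive x y ↔ l.Consecutive x y := by
  have (a b : α) : [a, b] <:+: l.reverse ↔ [b, a] <:+: l := by
    rw [← List.reverse_infix]; simp
  simp only [List.Consecutive, this, or_comm]

lemma List.Consecutive.mem_left {l : List α} {x y : α} (h : l.Consecutive x y) : x ∈ l := by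
  rcases h with h | h <;> exact h.subset (by simp)

lemma List.Consecutive.mem_right {l : List α} {x y : α} (h : l.Consecutive x y) : y ∈ l :=
  h.symm.mem_left

lemma List.Nodup.infix_pair_right_unique {l : List α} (hl : l.Nodup) {x y z : α}
    (hy : [x, y] <:+: l) (hz : [x, z] <:+: l) : y = z := by
  obtain ⟨a, b, rfl⟩ := hy
  obtain ⟨a', b', h⟩ := hz
  simp only [List.append_assoc, List.cons_append, List.nil_append] at h hl
  have h1 := (List.nodup_append.1 hl)
  have h2 := (List.nodup_append.1 (h ▸ hl))
  have hxa : x ∉ a := fun hx => h1.2.2 x hx x (by simp) rfl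
  have hxa' : x ∉ a' := fun hx => h2.2.2 x hx x (by simp) rfl
  have hxb : x ∉ y :: b := (List.nodup_cons.1 h1.2.1).1
  have hxb' : x ∉ z :: b' := (List.nodup_cons.1 h2.2.1).1
  have := (List.append_cons_inj_of_notMem hxa' hxb').1 h
  simp_all

lemma List.Nodup.infix_pair_left_unique {l : List α} (hl : l.Nodup) {x y z : α}
    (hy : [y, x] <:+: l) (hz : [z, x] <:+: l) : y = z := by
  rw [← List.reverse_infix] at hy hz
  exact (List.nodup_reverse.2 hl).infix_pair_right_unique (by simpa using hy) (by simpa using hz)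

/-- In a list without repetitions, an element has at most two neighbors. -/
lemma List.Nodup.consecutive_eq_or_eq {l : List α} (hl : l.Nodup) {v x y w : α} (hxy : x ≠ y)
    (hx : l.Consecutive v x) (hy : l.Consecutive v y) (hw : l.Consecutive v w) :
    w = x ∨ w = y := by
  rcases hx with hx | hx <;> rcases hy with hy | hy <;> rcases hw with hw | hw
  · exact absurd (hl.infix_pair_right_unique hx hy) hxy
  · exact absurd (hl.infix_pair_right_unique hx hy) hxy
  · exact .inl (hl.infix_pair_right_unique hw hx)
  · exact .inr (hl.infix_pair_left_unique hw hy)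
  · exact .inr (hl.infix_pair_right_unique hw hy)
  · exact .inl (hl.infix_pair_left_unique hw hx)
  · exact absurd (hl.infix_pair_left_unique hx hy) hxy
  · exact absurd (hl.infix_pair_left_unique hx hy) hxy

/-- An element that is neither first nor last has two distinct neighbors. -/
lemma List.Nodup.exists_consecutive {l : List α} (hl : l.Nodup) {v : α} (hv : v ∈ l)
    (hh : l.head? ≠ some v) (ht : l.getLast? ≠ some v) :
    ∃ x y, x ≠ y ∧ l.Consecutive v x ∧ l.Consecutive v y := by
  obtain ⟨a, b, rfl⟩ := List.append_of_mem hv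
  rcases List.eq_nil_or_concat a with rfl | ⟨a, x, rfl⟩
  · simp at hh
  rcases b with _ | ⟨y, b⟩
  · simp at ht
  refine ⟨x, y, ?_, .inr ⟨a, y :: b, by simp⟩, .inl ⟨a ++ [x], b, by simp⟩⟩
  rintro rfl
  simp [List.nodup_append] at hl

/-- At most `2 |S|` elements are next to some member of `S` in a list without repetitions. -/
lemma List.Nodup.card_le_of_consecutive {l : List α} (hl : l.Nodup)
    {S T : Finset α} (hT : ∀ v ∈ T, ∃ x ∈ S, l.Consecutive v x) : T.card ≤ 2 * S.card := by
  classical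
  have h1 : (T.filter fun v => ∃ x ∈ S, [v, x] <:+: l).card ≤ S.card := by
    refine Finset.card_le_card_of_forall_subsingleton (fun v x => [v, x] <:+: l) ?_ ?_
    · intro v hv
      exact (Finset.mem_filter.1 hv).2
    · intro x _ v hv w hw
      exact hl.infix_pair_left_unique hv.2 hw.2
  have h2 : (T.filter fun v => ∃ x ∈ S, [x, v] <:+: l).card ≤ S.card := by
    refine Finset.card_le_card_of_forall_subsingleton (fun v x => [x, v] <:+: l) ?_ ?_
    · intro v hv
      exact (Finset.mem_filter.1 hv).2
    · intro x _ v hv w hw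
      exact hl.infix_pair_right_unique hv.2 hw.2
  calc T.card ≤ ((T.filter fun v => ∃ x ∈ S, [v, x] <:+: l) ∪
        (T.filter fun v => ∃ x ∈ S, [x, v] <:+: l)).card := by
        refine Finset.card_le_card fun v hv => ?_
        obtain ⟨x, hx, h⟩ := hT v hv
        simp only [Finset.mem_union, Finset.mem_filter]
        exact h.imp (fun h => ⟨hv, x, hx, h⟩) (fun h => ⟨hv, x, hx, h⟩)
    _ ≤ _ := (Finset.card_union_le _ _).trans (by omega)

/-- `J` occurs as a block of consecutive entries of `l`, read forwards or backwards. -/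
def List.Segment (J l : List α) : Prop := J <:+: l ∨ J.reverse <:+: l

lemma List.Segment.consecutive {J l : List α} (h : J.Segment l) {x y : α}
    (hxy : J.Consecutive x y) : l.Consecutive x y := by
  rcases h with h | h
  · exact hxy.of_infix h
  · exact (List.consecutive_reverse.2 hxy).of_infix h

lemma List.Segment.subset {J l : List α} (h : J.Segment l) : J ⊆ l := by
  rcases h with h | h
  · exact h.subset
  · exact fun x hx => h.subset (List.mem_reverse.2 hx)

lemma List.Segment.reverse {J l : List α} (h : J.Segment l) : J.Segment l.reverse := by
  rcases h with h | h
  · exact .inr (List.reverse_infix.2 h)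
  · exact .inl (by simpa using List.reverse_infix.2 h)

/-- A block of `s ++ v :: t` that avoids `v` is a block of `s` or of `v :: t`. -/
lemma List.infix_or_infix_of_notMem {J s t : List α} {v : α} (hv : v ∉ J)
    (h : J <:+: s ++ v :: t) : J <:+: s ∨ J <:+: v :: t := by
  rw [List.infix_append_iff_ne_nil] at h
  rcases h with h | h | ⟨J₁, J₂, h1, h2, rfl, h3, h4⟩
  · exact .inl h
  · exact .inr h
  -- A block straddling the cut would have `v` as the first entry of its second part.
  · rcases J₂ with _ | ⟨w, J₂⟩
    · exact absurd rfl h2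
    · rw [List.cons_prefix_cons] at h4
      simp [h4.1] at hv

/-- Two blocks of `l` without common elements can be separated by cutting `l`. -/
lemma List.exists_append_of_infix {J J' l : List α} (hJ : J ≠ []) (hJ' : J' ≠ [])
    (hd : List.Disjoint J J') (h : J <:+: l) (h' : J' <:+: l) :
    ∃ l₁ l₂, l = l₁ ++ l₂ ∧ (J <:+: l₁ ∧ J' <:+: l₂ ∨ J' <:+: l₁ ∧ J <:+: l₂) := by
  obtain ⟨a, b, rfl⟩ := h
  rcases J with _ | ⟨v, J⟩
  · exact absurd rfl hJ
  rw [List.append_assoc, List.cons_append] at h'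
  rcases List.infix_or_infix_of_notMem (fun h => hd (by simp) h) h' with h | h
  · exact ⟨a, v :: (J ++ b), by simp, .inr ⟨h, ⟨[], b, by simp⟩⟩⟩
  · rw [← List.cons_append, List.infix_append_iff_ne_nil] at h
    rcases h with h | h | ⟨J₁, J₂, h1, -, rfl, h3, -⟩
    · obtain ⟨w, hw⟩ := List.exists_mem_of_ne_nil _ hJ'
      exact (hd (h.subset hw) hw).elim
    · exact ⟨a ++ v :: J, b, by simp, .inl ⟨⟨a, [], by simp⟩, h⟩⟩
    · obtain ⟨w, hw⟩ := List.exists_mem_of_ne_nil _ h1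
      exact (hd (h3.subset hw) (by simp [hw])).elim

lemma List.Segment.exists_append {J J' l : List α} (hJ : J ≠ []) (hJ' : J' ≠ [])
    (hd : List.Disjoint J J') (h : J.Segment l) (h' : J'.Segment l) :
    ∃ l₁ l₂, l = l₁ ++ l₂ ∧ (J.Segment l₁ ∧ J'.Segment l₂ ∨ J'.Segment l₁ ∧ J.Segment l₂) := by
  have key : ∀ I I' : List α, I ≠ [] → I' ≠ [] → List.Disjoint I I' → I <:+: l → I' <:+: l →
      (∀ m, I <:+: m → J.Segment m) → (∀ m, I' <:+: m → J'.Segment m) →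
      ∃ l₁ l₂, l = l₁ ++ l₂ ∧
        (J.Segment l₁ ∧ J'.Segment l₂ ∨ J'.Segment l₁ ∧ J.Segment l₂) := by
    intro I I' hI hI' hII h1 h2 f f'
    obtain ⟨l₁, l₂, rfl, hs⟩ := List.exists_append_of_infix hI hI' hII h1 h2
    exact ⟨l₁, l₂, rfl, hs.imp (fun h => ⟨f _ h.1, f' _ h.2⟩) (fun h => ⟨f' _ h.1, f _ h.2⟩)⟩
  rcases h with h | h <;> rcases h' with h' | h'
  · exact key _ _ hJ hJ' hd h h' (fun _ => .inl) (fun _ => .inl)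
  · exact key J J'.reverse hJ (by simpa) (by simpa [List.Disjoint] using hd) h h'
      (fun _ => .inl) (fun _ => .inr)
  · exact key J.reverse J' (by simpa) hJ' (by simpa [List.Disjoint] using hd) h h'
      (fun _ => .inr) (fun _ => .inl)
  · exact key J.reverse J'.reverse (by simpa) (by simpa) (by simpa [List.Disjoint] using hd) h h'
      (fun _ => .inr) (fun _ => .inr)

/-- A list of length at least `k * s` contains `k` blocks of length `s` without common elements. -/
lemma List.Nodup.exists_disjoint_infix {l : List α} (hl : l.Nodup) {k s : ℕ}
    (h : k * s ≤ l.length) :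
    ∃ J : Fin k → List α, (∀ i, J i <:+: l ∧ (J i).length = s) ∧
      ∀ i j, i ≠ j → List.Disjoint (J i) (J j) := by
  induction k generalizing l with
  | zero => exact ⟨fun i => i.elim0, fun i => i.elim0, fun i => i.elim0⟩
  | succ k ih =>
    have hs : s ≤ l.length := by nlinarith
    obtain ⟨J, hJ, hd⟩ := ih (l := l.drop s) (hl.sublist (l.drop_sublist s))
      (by rw [List.length_drop, Nat.le_sub_iff_add_le hs]; linarith)
    have h0 : ∀ i, List.Disjoint (l.take s) (J i) := fun i =>
      List.disjoint_of_subset_right (hJ i).1.subset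
        (List.disjoint_of_nodup_append (by simpa using hl))
    refine ⟨Fin.cons (l.take s) J, fun i => ?_, fun i j => ?_⟩
    · refine Fin.cases ⟨(l.take_prefix s).isInfix, by simpa using hs⟩ (fun i => ?_) i
      exact ⟨(hJ i).1.trans (l.drop_suffix s).isInfix, (hJ i).2⟩
    · refine Fin.cases (fun h => ?_) (fun i h => ?_) i <;>
        revert h <;> refine Fin.cases (fun h => ?_) (fun j h => ?_) j
      · exact absurd rfl h
      · exact h0 j
      · exact (h0 i).symm
      · exact hd i j (fun e => h (e ▸ rfl))

end ListAdjacency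

/-! ### Pósa rotations of a longest path -/

section Rotations

variable {V : Type*}

namespace SimpleGraph

variable {G : SimpleGraph V}

/-- The vertices of `l`, in this order, form a path of `G`. -/
def IsPathList (G : SimpleGraph V) (l : List V) : Prop := l.IsChain G.Adj ∧ l.Nodup

lemma IsPathList.reverse {l : List V} (h : G.IsPathList l) : G.IsPathList l.reverse := by
  refine ⟨List.isChain_reverse.2 ?_, List.nodup_reverse.2 h.2⟩
  exact h.1.imp fun _ _ h => h.symm

/-- `l'` arises from the path `l` by a Pósa rotation: the first vertex of `l` is adjacent to `v`,
and the part of `l` before `v` is reversed. -/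
def Rotation (G : SimpleGraph V) (v : V) (l l' : List V) : Prop :=
  ∃ s t, l = s ++ v :: t ∧ l' = s.reverse ++ v :: t ∧ ∃ u ∈ s.head?, G.Adj u v

lemma Rotation.perm {v : V} {l l' : List V} (h : G.Rotation v l l') : l'.Perm l := by
  obtain ⟨s, t, rfl, rfl, -⟩ := h
  exact (List.reverse_perm s).append_right _

lemma Rotation.getLast? {v : V} {l l' : List V} (h : G.Rotation v l l') :
    l'.getLast? = l.getLast? := by
  obtain ⟨s, t, rfl, rfl, -⟩ := h
  rw [List.getLast?_append, List.getLast?_append]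
  cases h : (v :: t).getLast? with
  | none => simp at h
  | some x => rfl

lemma Rotation.isPathList {v : V} {l l' : List V} (h : G.Rotation v l l')
    (hl : G.IsPathList l) : G.IsPathList l' := by
  refine ⟨?_, h.perm.nodup_iff.2 hl.2⟩
  obtain ⟨s, t, rfl, rfl, u, hu, huv⟩ := h
  have h1 := List.isChain_append.1 hl.1
  refine List.isChain_append.2 ⟨List.isChain_reverse.2 (h1.1.imp fun _ _ h => h.symm), h1.2.1, ?_⟩
  intro x hx y hy
  rw [List.getLast?_reverse] at hx
  simp only [List.head?_cons, Option.mem_def, Option.some.injEq] at hy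
  rw [Option.mem_unique hx hu, ← hy]
  exact huv

/-- A path can be rotated at each neighbor of its first vertex. -/
lemma exists_rotation {l : List V} {u v : V} (hu : u ∈ l.head?) (huv : G.Adj u v)
    (hv : v ∈ l) :
    ∃ w l', G.Rotation v l l' ∧ w ∈ l'.head? ∧ l.Consecutive v w := by
  obtain ⟨s, t, rfl⟩ := List.append_of_mem hv
  rcases List.eq_nil_or_concat s with rfl | ⟨s, w, rfl⟩
  · simp at hu
    exact (huv.ne hu.symm).elim
  · refine ⟨w, _, ⟨_, t, rfl, rfl, u, ?_, huv⟩, by simp, .inr ⟨s, t, by simp⟩⟩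
    rcases s with _ | ⟨a, s⟩ <;> simpa using hu

/-- A rotation at `v` keeps each block that avoids `v`. -/
lemma Rotation.segment {v : V} {l l' J : List V} (h : G.Rotation v l l') (hv : v ∉ J)
    (hJ : J.Segment l) : J.Segment l' := by
  obtain ⟨s, t, rfl, rfl, -⟩ := h
  have key : ∀ I : List V, v ∉ I → I <:+: s ++ v :: t → I.Segment (s.reverse ++ v :: t) := by
    intro I hI h
    rcases List.infix_or_infix_of_notMem hI h with h | h
    · exact .inr ((List.reverse_infix.2 h).trans (List.infix_append' [] _ _))
    · exact .inl (h.trans (List.infix_append_right))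
  rcases hJ with h | h
  · exact key J hv h
  · have := key J.reverse (by simpa) h
    rwa [List.Segment, List.reverse_reverse, or_comm] at this

/-- A rotation destroys at most one adjacency, and an end of it becomes the first vertex. -/
lemma Rotation.consecutive {v : V} {l l' : List V} (h : G.Rotation v l l') {x y : V}
    (hxy : l.Consecutive x y) :
    l'.Consecutive x y ∨ x ∈ l'.head? ∨ y ∈ l'.head? := by
  obtain ⟨s, t, rfl, rfl, -⟩ := h
  have key : ∀ a b : V, [a, b] <:+: s ++ v :: t → [b, a] <:+: s.reverse ++ v :: t ∨
      [a, b] <:+: s.reverse ++ v :: t ∨ a ∈ (s.reverse ++ v :: t).head? := by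
    intro a b h
    rw [List.infix_append_iff_ne_nil] at h
    rcases h with h | h | ⟨J₁, J₂, h1, h2, h3, h4, h5⟩
    · refine .inl ((List.reverse_infix.2 h).trans ?_)
      simpa using List.infix_append' [] s.reverse (v :: t)
    · exact .inr (.inl (h.trans List.infix_append_right))
    -- The pair straddles the cut, so `a` is the last entry of `s` and heads `s.reverse`.
    · right; right
      rcases J₁ with _ | ⟨c, _ | ⟨d, J⟩⟩
      · exact absurd rfl h1
      · obtain ⟨s', rfl⟩ := h4
        simp at h3
        simp [h3.1]
      · have h6 := congrArg List.length h3
        have h7 := List.length_pos_of_ne_nil h2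
        simp only [List.length_cons, List.length_nil, List.length_append] at h6
        omega
  rcases hxy with h | h
  · rcases key _ _ h with h | h | h
    · exact .inl (.inr h)
    · exact .inl (.inl h)
    · exact .inr (.inl h)
  · rcases key _ _ h with h | h | h
    · exact .inl (.inl h)
    · exact .inl (.inr h)
    · exact .inr (.inr h)

/-- Pósa's lemma for one path `l`: suppose every pair consecutive in the reference list `J` is
still consecutive in `l` or meets `R`. If the first vertex of `l` is adjacent to `v`, and `x`, `y`
are the two neighbors of `v` in `J`, then `R` contains `v`, `x` or `y`, or rotating `l` at `v`
makes `x` or `y` the first vertex. -/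
lemma rotation_alternative {J l : List V} {R : V → Prop} (hl : l.Nodup)
    (hJ : ∀ x y, J.Consecutive x y → l.Consecutive x y ∨ R x ∨ R y)
    {u v x y : V} (hu : u ∈ l.head?) (huv : G.Adj u v) (hv : v ∈ l) (hxy : x ≠ y)
    (hx : J.Consecutive v x) (hy : J.Consecutive v y) :
    R v ∨ R x ∨ R y ∨ ∃ l', G.Rotation v l l' ∧ (x ∈ l'.head? ∨ y ∈ l'.head?) := by
  rcases hJ _ _ hx with hx' | h | h
  · rcases hJ _ _ hy with hy' | h | h
    · obtain ⟨w, l', hr, hw, hc⟩ := exists_rotation hu huv hv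
      refine .inr (.inr (.inr ⟨l', hr, ?_⟩))
      rcases hl.consecutive_eq_or_eq hxy hx' hy' hc with rfl | rfl
      · exact .inl hw
      · exact .inr hw
    · exact .inl h
    · exact .inr (.inr (.inl h))
  · exact .inl h
  · exact .inr (.inl h)

/-- `l` arises from `l₀` by at most `t` rotations. -/
inductive RotatesTo (G : SimpleGraph V) (l₀ : List V) : ℕ → List V → Prop
  | refl (t : ℕ) : RotatesTo G l₀ t l₀
  | step {t : ℕ} {v : V} {l l' : List V} (h : RotatesTo G l₀ t l) (hr : G.Rotation v l l') :
      RotatesTo G l₀ (t + 1) l'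

lemma RotatesTo.succ {l₀ l : List V} {t : ℕ} (h : G.RotatesTo l₀ t l) :
    G.RotatesTo l₀ (t + 1) l := by
  induction h with
  | refl t => exact .refl _
  | step _ hr ih => exact .step ih hr

lemma RotatesTo.perm {l₀ l : List V} {t : ℕ} (h : G.RotatesTo l₀ t l) : l.Perm l₀ := by
  induction h with
  | refl t => exact .refl _
  | step _ hr ih => exact hr.perm.trans ih

lemma RotatesTo.getLast? {l₀ l : List V} {t : ℕ} (h : G.RotatesTo l₀ t l) :
    l.getLast? = l₀.getLast? := by
  induction h with
  | refl t => rfl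
  | step _ hr ih => exact hr.getLast?.trans ih

lemma RotatesTo.isPathList {l₀ l : List V} {t : ℕ} (h : G.RotatesTo l₀ t l)
    (h₀ : G.IsPathList l₀) : G.IsPathList l := by
  induction h with
  | refl t => exact h₀
  | step _ hr ih => exact hr.isPathList ih

/-- Among disjoint blocks, at most `t` are destroyed by `t` rotations. -/
lemma RotatesTo.exists_destroyed {ι : Type*} [DecidableEq ι] {J : ι → List V}
    (hJ : ∀ i j, i ≠ j → List.Disjoint (J i) (J j)) {l₀ l : List V} {t : ℕ}
    (h : G.RotatesTo l₀ t l) :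
    ∃ B : Finset ι, B.card ≤ t ∧ ∀ i, i ∉ B → (J i).Segment l₀ → (J i).Segment l := by
  induction h with
  | refl t => exact ⟨∅, by simp, fun _ _ h => h⟩
  | @step t v l l' _ hr ih =>
    obtain ⟨B, hB, h⟩ := ih
    -- By disjointness the pivot `v` lies in at most one block.
    by_cases hv : ∃ i, v ∈ J i
    · obtain ⟨i, hi⟩ := hv
      refine ⟨insert i B, (Finset.card_insert_le _ _).trans (by omega), fun j hj h0 => ?_⟩
      rw [Finset.mem_insert, not_or] at hj
      exact hr.segment (fun hv => hJ _ _ hj.1 hv hi) (h j hj.2 h0)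
    · exact ⟨B, by omega, fun j hj h0 => hr.segment (fun hv' => hv ⟨j, hv'⟩) (h j hj h0)⟩

/-- `l` is a path with the largest possible number of vertices. -/
def IsLongestPathList (G : SimpleGraph V) (l : List V) : Prop :=
  G.IsPathList l ∧ ∀ l', G.IsPathList l' → l'.length ≤ l.length

lemma IsLongestPathList.of_perm {l l' : List V} (h : G.IsLongestPathList l)
    (hl' : G.IsPathList l') (hp : l'.Perm l) : G.IsLongestPathList l' :=
  ⟨hl', fun m hm => hp.length_eq ▸ h.2 m hm⟩

/-- Otherwise `v` could be prepended. -/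
lemma IsLongestPathList.mem_of_adj_head {l : List V} (h : G.IsLongestPathList l) {u v : V}
    (hu : u ∈ l.head?) (huv : G.Adj u v) : v ∈ l := by
  by_contra hv
  have : G.IsPathList (v :: l) :=
    ⟨List.isChain_cons.2 ⟨fun y hy => (Option.mem_unique hy hu) ▸ huv.symm, h.1.1⟩,
      List.nodup_cons.2 ⟨hv, h.1.2⟩⟩
  have := h.2 _ this
  simp at this

open Classical in
/-- The first vertices of the paths that arise from `l₀` by at most `t` rotations. -/
noncomputable def rotationEnds [Fintype V] (G : SimpleGraph V) (l₀ : List V) (t : ℕ) : Finset V :=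
  Finset.univ.filter fun u => ∃ l, G.RotatesTo l₀ t l ∧ u ∈ l.head?

variable [Fintype V]

lemma mem_rotationEnds {l₀ : List V} {t : ℕ} {u : V} :
    u ∈ G.rotationEnds l₀ t ↔ ∃ l, G.RotatesTo l₀ t l ∧ u ∈ l.head? := by
  simp [rotationEnds]

lemma rotationEnds_subset_succ {l₀ : List V} {t : ℕ} :
    G.rotationEnds l₀ t ⊆ G.rotationEnds l₀ (t + 1) := fun u hu => by
  obtain ⟨l, h, hl⟩ := mem_rotationEnds.1 hu
  exact mem_rotationEnds.2 ⟨l, h.succ, hl⟩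

/-- Supplies the hypothesis of `rotation_alternative` with `l₀` as the reference list. -/
lemma RotatesTo.consecutive {l₀ l : List V} {t : ℕ} (h : G.RotatesTo l₀ t l) {x y : V}
    (hxy : l₀.Consecutive x y) :
    l.Consecutive x y ∨ x ∈ G.rotationEnds l₀ t ∨ y ∈ G.rotationEnds l₀ t := by
  induction h with
  | refl t => exact .inl hxy
  | step h hr ih =>
    rcases ih with ih | ih | ih
    · rcases hr.consecutive ih with h' | h' | h'
      · exact .inl h'
      · exact .inr (.inl (mem_rotationEnds.2 ⟨_, .step h hr, h'⟩))
      · exact .inr (.inr (mem_rotationEnds.2 ⟨_, .step h hr, h'⟩))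
    · exact .inr (.inl (rotationEnds_subset_succ ih))
    · exact .inr (.inr (rotationEnds_subset_succ ih))

lemma mem_externalNeighborhood {S : Finset V} {v : V} :
    v ∈ externalNeighborhood G S ↔ v ∉ S ∧ ∃ u ∈ S, G.Adj u v := by
  simp [externalNeighborhood]

lemma exists_isLongestPathList (G : SimpleGraph V) : ∃ l, G.IsLongestPathList l := by
  classical
  have hb : ∀ k, (∃ l, G.IsPathList l ∧ l.length = k) → k ≤ Fintype.card V := by
    rintro _ ⟨l, hl, rfl⟩
    exact hl.2.length_le_card
  have h0 : ∃ l, G.IsPathList l ∧ l.length = 0 := ⟨[], ⟨.nil, List.nodup_nil⟩, rfl⟩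
  obtain ⟨l, hl, hk⟩ := Nat.findGreatest_spec
    (P := fun k => ∃ l, G.IsPathList l ∧ l.length = k) (Nat.zero_le (Fintype.card V)) h0
  exact ⟨l, hl, fun l' hl' => hk ▸ Nat.le_findGreatest (hb _ ⟨l', hl', rfl⟩) ⟨l', hl', rfl⟩⟩

lemma IsLongestPathList.mem_of_adj_rotationEnds {l₀ : List V} (h : G.IsLongestPathList l₀) {t : ℕ}
    {u v : V} (hu : u ∈ G.rotationEnds l₀ t) (huv : G.Adj u v) : v ∈ l₀ := by
  obtain ⟨l, hl, hul⟩ := mem_rotationEnds.1 hu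
  exact hl.perm.mem_iff.1
    ((h.of_perm (hl.isPathList h.1) hl.perm).mem_of_adj_head hul huv)

/-- Pósa's lemma with a bound on the number of rotations. -/
lemma IsLongestPathList.card_externalNeighborhood_le {l₀ : List V} (h : G.IsLongestPathList l₀)
    {t : ℕ} {S : Finset V} (hS : S ⊆ G.rotationEnds l₀ t) :
    (externalNeighborhood G S).card ≤ 3 * (G.rotationEnds l₀ (t + 1)).card + 1 := by
  classical
  -- Each `v` in `T` has two neighbors in `l₀`, one of which is an end after `t + 1` rotations, so
  -- `T` has at most twice as many elements as there are such ends. The removed earlier ends account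
  -- for the third multiple, the last vertex for the `+ 1`.
  set T := externalNeighborhood G S \ (G.rotationEnds l₀ t ∪ l₀.getLast?.toFinset) with hT
  have hsub : ∀ v ∈ T, ∃ x ∈ G.rotationEnds l₀ (t + 1), l₀.Consecutive v x := by
    intro v hv
    rw [hT, Finset.mem_sdiff, Finset.mem_union, not_or, Option.mem_toFinset] at hv
    obtain ⟨hv, hvR, hlast⟩ := hv
    obtain ⟨-, u, huS, huv⟩ := mem_externalNeighborhood.1 hv
    have hv₀ := h.mem_of_adj_rotationEnds (hS huS) huv
    obtain ⟨x, y, hxy, hx, hy⟩ := h.1.2.exists_consecutive hv₀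
      (fun hh => hvR (mem_rotationEnds.2 ⟨l₀, .refl _, hh⟩)) hlast
    obtain ⟨l, hl, hul⟩ := mem_rotationEnds.1 (hS huS)
    rcases rotation_alternative (R := (· ∈ G.rotationEnds l₀ t)) (hl.isPathList h.1).2
      (fun x y => hl.consecutive) hul huv (hl.perm.mem_iff.2 hv₀) hxy hx hy with
      h' | h' | h' | ⟨l', hr, h' | h'⟩
    · exact absurd h' hvR
    · exact ⟨x, rotationEnds_subset_succ h', hx⟩
    · exact ⟨y, rotationEnds_subset_succ h', hy⟩
    · exact ⟨x, mem_rotationEnds.2 ⟨l', .step hl hr, h'⟩, hx⟩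
    · exact ⟨y, mem_rotationEnds.2 ⟨l', .step hl hr, h'⟩, hy⟩
  have h1 := Finset.card_le_card (rotationEnds_subset_succ (G := G) (l₀ := l₀) (t := t))
  have h2 := h.1.2.card_le_of_consecutive hsub
  have h3 : l₀.getLast?.toFinset.card ≤ 1 := by
    cases l₀.getLast? <;> simp
  have h4 := Finset.card_le_card_sdiff_add_card (s := externalNeighborhood G S)
    (t := G.rotationEnds l₀ t ∪ l₀.getLast?.toFinset)
  rw [← hT] at h4
  have h5 := Finset.card_union_le (G.rotationEnds l₀ t) l₀.getLast?.toFinset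
  omega

end SimpleGraph

end Rotations

/-! ### Rotations confined to a block, and closing a path -/

section LocalRotations

namespace SimpleGraph

variable {V : Type*} {G : SimpleGraph V}

/-- Any two disjoint sets of at least `M` vertices are joined by an edge. -/
def JoinsSets (G : SimpleGraph V) (M : ℕ) : Prop :=
  ∀ A B : Finset V, Disjoint A B → M ≤ A.card → M ≤ B.card → ∃ a ∈ A, ∃ b ∈ B, G.Adj a b

/-- `A` and `B` may overlap; `2 * M` leaves `M` vertices of `B` outside any `M` vertices of `A`. -/
lemma JoinsSets.card_le_of_no_adj {M : ℕ} (h : G.JoinsSets M) {A B : Finset V}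
    (hB : 2 * M ≤ B.card) (hAB : ∀ a ∈ A, ∀ b ∈ B, ¬ G.Adj a b) : A.card < M := by
  classical
  by_contra! hA
  obtain ⟨A', hA', hc⟩ := Finset.exists_subset_card_eq hA
  have := Finset.card_le_card_sdiff_add_card (s := B) (t := A')
  obtain ⟨a, ha, b, hb, hadj⟩ := h A' (B \ A') Finset.disjoint_sdiff hc.ge (by omega)
  exact hAB a (hA' ha) b (Finset.mem_sdiff.1 hb).1 hadj

/-- A closed path is moved so as to start at any of its vertices. -/
lemma IsPathList.exists_rotate {l : List V} {x y z : V} (hl : G.IsPathList l)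
    (hx : x ∈ l.head?) (hy : y ∈ l.getLast?) (hxy : G.Adj x y) (hz : z ∈ l) :
    ∃ l', G.IsPathList l' ∧ l'.Perm l ∧ z ∈ l'.head? := by
  obtain ⟨s, t, rfl⟩ := List.append_of_mem hz
  have hc := List.isChain_append.1 hl.1
  have hp : (z :: t ++ s).Perm (s ++ z :: t) := List.perm_append_comm
  refine ⟨z :: t ++ s, ⟨List.isChain_append.2 ⟨hc.2.1, hc.1, fun a ha b hb => ?_⟩,
    hp.nodup_iff.2 hl.2⟩, hp, by simp⟩
  rw [List.getLast?_append_of_ne_nil _ (by simp)] at hy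
  cases Option.mem_unique ha hy
  rw [List.head?_append, Option.mem_def.1 hb] at hx
  cases hx
  exact hxy.symm

variable [Fintype V]

open Classical in
/-- The vertices that have two distinct neighbors in the list `J` belonging to `D`. -/
noncomputable def listInterior (J : List V) (D : Finset V) : Finset V :=
  Finset.univ.filter fun v => ∃ x ∈ D, ∃ y ∈ D, x ≠ y ∧ J.Consecutive v x ∧ J.Consecutive v y

lemma mem_listInterior {J : List V} {D : Finset V} {v : V} : v ∈ listInterior J D ↔
    ∃ x ∈ D, ∃ y ∈ D, x ≠ y ∧ J.Consecutive v x ∧ J.Consecutive v y := by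
  simp [listInterior]

lemma listInterior_mono {J : List V} {D D' : Finset V} (h : D ⊆ D') :
    listInterior J D ⊆ listInterior J D' := by
  intro v hv
  obtain ⟨x, hx, y, hy, h'⟩ := mem_listInterior.1 hv
  exact mem_listInterior.2 ⟨x, h hx, y, h hy, h'⟩

variable [DecidableEq V]

/-- No edge joins `S` to the complement of `S` and its neighborhood, so that complement has fewer
than `M` vertices. -/
lemma JoinsSets.card_univ_le {M : ℕ} (h : G.JoinsSets M) {S : Finset V} (hS : M ≤ S.card) :
    Fintype.card V < S.card + (externalNeighborhood G S).card + M := by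
  by_contra! hc
  have h1 := Finset.card_union_le S (externalNeighborhood G S)
  have h2 := Finset.card_compl_add_card (S ∪ externalNeighborhood G S)
  obtain ⟨a, ha, b, hb, hadj⟩ := h S (S ∪ externalNeighborhood G S)ᶜ
    (Finset.disjoint_left.2 fun x hx hx' => Finset.mem_compl.1 hx' (Finset.mem_union_left _ hx))
    hS (by omega)
  rw [Finset.mem_compl, Finset.mem_union, not_or] at hb
  exact hb.2 (mem_externalNeighborhood.2 ⟨hb.1, a, ha, hadj⟩)

/-- Apart from the two ends of `J`, a vertex outside the interior is next to `B`. -/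
lemma length_le_card_listInterior {J : List V} (hJ : J.Nodup) (B : Finset V) :
    J.length ≤ (listInterior J (J.toFinset \ B)).card + 2 * B.card + 2 := by
  set T := J.toFinset \ (listInterior J (J.toFinset \ B) ∪
    (J.head?.toFinset ∪ J.getLast?.toFinset)) with hT
  have h1 : ∀ v ∈ T, ∃ x ∈ B, J.Consecutive v x := by
    intro v hv
    simp only [hT, Finset.mem_sdiff, Finset.mem_union, not_or, Option.mem_toFinset,
      List.mem_toFinset] at hv
    obtain ⟨hv, hi, hh, hl⟩ := hv
    obtain ⟨x, y, hxy, hx, hy⟩ := hJ.exists_consecutive hv hh hl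
    by_contra! hc
    refine hi (mem_listInterior.2 ⟨x, ?_, y, ?_, hxy, hx, hy⟩)
    · simpa [hx.mem_right] using fun h => hc x h hx
    · simpa [hy.mem_right] using fun h => hc y h hy
  have h2 := hJ.card_le_of_consecutive h1
  have h3 := Finset.card_le_card_sdiff_add_card (s := J.toFinset)
    (t := listInterior J (J.toFinset \ B) ∪ (J.head?.toFinset ∪ J.getLast?.toFinset))
  rw [← hT, List.toFinset_card_of_nodup hJ] at h3
  have h4 := Finset.card_union_le (listInterior J (J.toFinset \ B))
    (J.head?.toFinset ∪ J.getLast?.toFinset)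
  have h5 := Finset.card_union_le J.head?.toFinset J.getLast?.toFinset
  have h6 : J.head?.toFinset.card ≤ 1 := by cases J.head? <;> simp
  have h7 : J.getLast?.toFinset.card ≤ 1 := by cases J.getLast? <;> simp
  omega

/-- Each long block `J` has a large part `D` in which small sets expand into the interior. -/
lemma JoinsSets.exists_expanding_part {M : ℕ} (h : G.JoinsSets M) {J : List V}
    (hJ : J.Nodup) (hlen : 11 * M + 3 ≤ J.length) :
    ∃ D ⊆ J.toFinset, 2 * M ≤ (listInterior J D).card ∧
      ∀ S ⊆ D, S.Nonempty → S.card ≤ M →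
        2 * S.card < (externalNeighborhood G S ∩ listInterior J D).card := by
  classical
  -- Deleting a largest non-expanding set `B` leaves the desired part: a non-expanding `S` in the
  -- rest could be added to `B`.
  let P : Finset V → Prop := fun B => B ⊆ J.toFinset ∧ B.card ≤ 2 * M ∧
    (externalNeighborhood G B ∩ listInterior J (J.toFinset \ B)).card ≤ 2 * B.card
  -- If `M ≤ |B| ≤ 2 M`, the interior has at least `7 M + 1` vertices and `B` has more than `|V| - 3
  -- M` neighbors, so over `4 M` neighbors lie in the interior. The gap below `2 M` leaves room to
  -- add `S`.
  have hsmall : ∀ B, P B → B.card < M := by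
    rintro B ⟨-, hB, hN⟩
    by_contra! hc
    have h1 := h.card_univ_le hc
    have h2 := length_le_card_listInterior hJ B
    have h3 := Finset.card_union_add_card_inter (externalNeighborhood G B)
      (listInterior J (J.toFinset \ B))
    have h4 := Finset.card_le_univ
      (externalNeighborhood G B ∪ listInterior J (J.toFinset \ B))
    omega
  obtain ⟨B, hB, hmax⟩ := Finset.exists_max_image (Finset.univ.filter P) Finset.card
    ⟨∅, by
      have h0 : externalNeighborhood G ∅ = ∅ := by ext; simp [mem_externalNeighborhood]
      simp [P, h0]⟩
  simp only [Finset.mem_filter, Finset.mem_univ, true_and] at hB hmax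
  have hBM := hsmall B hB
  refine ⟨J.toFinset \ B, Finset.sdiff_subset, ?_, fun S hS hne hSM => ?_⟩
  · have := length_le_card_listInterior hJ B
    omega
  · by_contra! hc
    have hdisj : Disjoint B S :=
      Finset.disjoint_left.2 fun x hx hx' => (Finset.mem_sdiff.1 (hS hx')).2 hx
    have hcard := Finset.card_union_of_disjoint hdisj
    have hP : P (B ∪ S) := by
      refine ⟨Finset.union_subset hB.1 (hS.trans Finset.sdiff_subset), by omega, ?_⟩
      have hsub : externalNeighborhood G (B ∪ S) ∩ listInterior J (J.toFinset \ (B ∪ S)) ⊆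
          (externalNeighborhood G B ∩ listInterior J (J.toFinset \ B)) ∪
          (externalNeighborhood G S ∩ listInterior J (J.toFinset \ B)) := by
        intro v hv
        obtain ⟨hv, hi⟩ := Finset.mem_inter.1 hv
        have hi' := listInterior_mono
          (Finset.sdiff_subset_sdiff le_rfl (Finset.subset_union_left (s₂ := S))) hi
        obtain ⟨hn, u, hu, hadj⟩ := mem_externalNeighborhood.1 hv
        rw [Finset.mem_union, not_or] at hn
        rcases Finset.mem_union.1 hu with hu | hu
        · exact Finset.mem_union_left _ (Finset.mem_inter.2
            ⟨mem_externalNeighborhood.2 ⟨hn.1, u, hu, hadj⟩, hi'⟩)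
        · exact Finset.mem_union_right _ (Finset.mem_inter.2
            ⟨mem_externalNeighborhood.2 ⟨hn.2, u, hu, hadj⟩, hi'⟩)
      have h1 := Finset.card_le_card hsub
      have h2 := Finset.card_union_le
        (externalNeighborhood G B ∩ listInterior J (J.toFinset \ B))
        (externalNeighborhood G S ∩ listInterior J (J.toFinset \ B))
      have h3 := hB.2.2
      omega
    have h1 := hmax _ hP
    have h2 := hne.card_pos
    omega

/-- Rotating only with new first vertices in the expanding part `D` of a block `J` of the path
yields more than `M` first vertices in `D`. The last vertex does not change. -/
lemma exists_many_ends {M : ℕ} {J l : List V} {D : Finset V} (hJ : J.Nodup)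
    (hD : ∀ S ⊆ D, S.Nonempty → S.card ≤ M →
      2 * S.card < (externalNeighborhood G S ∩ listInterior J D).card)
    (hl : G.IsPathList l) (hJl : J.Segment l) {u v : V} (hu : u ∈ l.head?)
    (hv : v ∈ listInterior J D) (huv : G.Adj u v) :
    ∃ R ⊆ D, M < R.card ∧ ∀ w ∈ R, ∃ l', G.IsPathList l' ∧ l'.Perm l ∧ w ∈ l'.head? ∧
      l'.getLast? = l.getLast? := by
  classical
  let Step : List V → List V → Prop := fun l l' => ∃ v, G.Rotation v l l' ∧ ∃ w ∈ D, w ∈ l'.head?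
  let R : Finset V := D.filter fun w => ∃ l', Relation.ReflTransGen Step l l' ∧ w ∈ l'.head?
  have hR : ∀ w, w ∈ R ↔ w ∈ D ∧ ∃ l', Relation.ReflTransGen Step l l' ∧ w ∈ l'.head? := by
    simp [R]
  have hpath : ∀ l', Relation.ReflTransGen Step l l' → G.IsPathList l' ∧ l'.Perm l ∧
      l'.getLast? = l.getLast? := by
    intro l' h
    induction h with
    | refl => exact ⟨hl, .refl _, rfl⟩
    | tail _ h ih =>
      obtain ⟨v, hr, -⟩ := h
      exact ⟨hr.isPathList ih.1, hr.perm.trans ih.2.1, hr.getLast?.trans ih.2.2⟩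
  have hcons : ∀ l', Relation.ReflTransGen Step l l' → ∀ x y, J.Consecutive x y →
      l'.Consecutive x y ∨ x ∈ R ∨ y ∈ R := by
    intro l' h
    induction h with
    | refl => exact fun x y hxy => .inl (hJl.consecutive hxy)
    | @tail l₁ l₂ h₁ h₂ ih =>
      intro x y hxy
      have hhead : ∀ x ∈ l₂.head?, x ∈ R := by
        intro x hx
        obtain ⟨v, hr, w, hw, hw'⟩ := h₂
        cases Option.mem_unique hx hw'
        exact (hR x).2 ⟨hw, l₂, h₁.tail ⟨v, hr, x, hw, hx⟩, hx⟩
      rcases ih x y hxy with h | h | h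
      · obtain ⟨v, hr, -⟩ := h₂
        exact (hr.consecutive h).imp_right (Or.imp (hhead x) (hhead y))
      · exact .inr (.inl h)
      · exact .inr (.inr h)
  -- Both neighbors of `v` in `J` lie in `D`, so whichever of them becomes first, the rotation is an
  -- allowed step.
  have hstep : ∀ l', Relation.ReflTransGen Step l l' → ∀ u ∈ l'.head?, ∀ v ∈ listInterior J D,
      G.Adj u v → v ∉ R → ∃ x ∈ R, J.Consecutive v x := by
    intro l' h u hu v hv huv hvR
    obtain ⟨x, hx, y, hy, hxy, hvx, hvy⟩ := mem_listInterior.1 hv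
    have hvl : v ∈ l' := (hpath l' h).2.1.mem_iff.2 (hJl.subset hvx.mem_left)
    rcases rotation_alternative (R := (· ∈ R)) (hpath l' h).1.2 (hcons l' h) hu huv hvl hxy hvx hvy
      with h' | h' | h' | ⟨l'', hr, h' | h'⟩
    · exact absurd h' hvR
    · exact ⟨x, h', hvx⟩
    · exact ⟨y, h', hvy⟩
    · exact ⟨x, (hR x).2 ⟨hx, l'', h.tail ⟨v, hr, x, hx, h'⟩, h'⟩, hvx⟩
    · exact ⟨y, (hR y).2 ⟨hy, l'', h.tail ⟨v, hr, y, hy, h'⟩, h'⟩, hvy⟩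
  have hne : R.Nonempty := by
    by_cases hvR : v ∈ R
    · exact ⟨v, hvR⟩
    · obtain ⟨x, hx, -⟩ := hstep l .refl u hu v hv huv hvR
      exact ⟨x, hx⟩
  refine ⟨R, Finset.filter_subset _ _, ?_, fun w hw => ?_⟩
  -- By `hstep` every interior neighbor of `R` is next to `R` in `J`, so there are at most `2 |R|`
  -- of them, against `hD`.
  · by_contra! hc
    have h1 := hD R (Finset.filter_subset _ _) hne hc
    have h2 : (externalNeighborhood G R ∩ listInterior J D).card ≤ 2 * R.card := by
      refine hJ.card_le_of_consecutive fun v hv => ?_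
      obtain ⟨hv, hi⟩ := Finset.mem_inter.1 hv
      obtain ⟨hvR, u, hu, hadj⟩ := mem_externalNeighborhood.1 hv
      obtain ⟨-, l', hl', hul'⟩ := (hR u).1 hu
      exact hstep l' hl' u hul' v hi hadj hvR
    omega
  · obtain ⟨-, l', hl', hw'⟩ := (hR w).1 hw
    obtain ⟨h1, h2, h3⟩ := hpath l' hl'
    exact ⟨l', h1, h2, hw', h3⟩

/-- If both ends of a path see the expanding parts of two blocks that lie on their respective
sides, then the vertices of the path span a cycle. -/
lemma JoinsSets.exists_closed_path {M : ℕ} (h : G.JoinsSets M) {J₁ J₂ l₁ l₂ : List V}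
    {D₁ D₂ : Finset V} (hJ₁ : J₁.Nodup) (hJ₂ : J₂.Nodup) (hD₁J : D₁ ⊆ J₁.toFinset)
    (hD₂J : D₂ ⊆ J₂.toFinset)
    (hD₁ : ∀ S ⊆ D₁, S.Nonempty → S.card ≤ M →
      2 * S.card < (externalNeighborhood G S ∩ listInterior J₁ D₁).card)
    (hD₂ : ∀ S ⊆ D₂, S.Nonempty → S.card ≤ M →
      2 * S.card < (externalNeighborhood G S ∩ listInterior J₂ D₂).card)
    (hdisj : List.Disjoint J₁ J₂) (hl : G.IsPathList (l₁ ++ l₂))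
    (h₁ : J₁.Segment l₁) (h₂ : J₂.Segment l₂) {b a : V}
    (hb : b ∈ (l₁ ++ l₂).head?) (ha : a ∈ (l₁ ++ l₂).getLast?)
    (hb' : ∃ v ∈ listInterior J₁ D₁, G.Adj b v) (ha' : ∃ v ∈ listInterior J₂ D₂, G.Adj a v) :
    ∃ l x y, G.IsPathList l ∧ l.Perm (l₁ ++ l₂) ∧ x ∈ l.head? ∧ y ∈ l.getLast? ∧ G.Adj x y := by
  obtain ⟨v₁, hv₁, hbv⟩ := hb'
  obtain ⟨v₂, hv₂, hav⟩ := ha'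
  have hne₁ : l₁ ≠ [] := by
    obtain ⟨x, -, y, -, -, hx, -⟩ := mem_listInterior.1 hv₁
    exact List.ne_nil_of_mem (h₁.subset hx.mem_left)
  have hne₂ : l₂ ≠ [] := by
    obtain ⟨x, -, y, -, -, hx, -⟩ := mem_listInterior.1 hv₂
    exact List.ne_nil_of_mem (h₂.subset hx.mem_left)
  have hc := List.isChain_append.1 hl.1
  have hn := List.nodup_append.1 hl.2
  -- Each half is rotated at its outer end. Its inner end stays fixed, so the edge between the
  -- halves survives.
  obtain ⟨R₁, hR₁, hM₁, hp₁⟩ := exists_many_ends hJ₁ hD₁ ⟨hc.1, hn.1⟩ h₁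
    (by rwa [List.head?_append_of_ne_nil _ hne₁] at hb) hv₁ hbv
  obtain ⟨R₂, hR₂, hM₂, hp₂⟩ := exists_many_ends hJ₂ hD₂
    (IsPathList.reverse ⟨hc.2.1, hn.2.1⟩) h₂.reverse
    (by rwa [List.getLast?_append_of_ne_nil _ hne₂, ← List.head?_reverse] at ha) hv₂ hav
  obtain ⟨x, hx, y, hy, hadj⟩ := h R₁ R₂ (Finset.disjoint_left.2 fun z hz hz' =>
    hdisj (List.mem_toFinset.1 (hD₁J (hR₁ hz))) (List.mem_toFinset.1 (hD₂J (hR₂ hz'))))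
    hM₁.le hM₂.le
  obtain ⟨p₁, hpath₁, hperm₁, hx₁, hlast₁⟩ := hp₁ x hx
  obtain ⟨p₂, hpath₂, hperm₂, hy₂, hlast₂⟩ := hp₂ y hy
  have hperm : (p₁ ++ p₂.reverse).Perm (l₁ ++ l₂) :=
    hperm₁.append ((List.reverse_perm _).trans (hperm₂.trans (List.reverse_perm _)))
  refine ⟨p₁ ++ p₂.reverse, x, y, ⟨List.isChain_append.2 ⟨hpath₁.1, hpath₂.reverse.1, ?_⟩,
    hperm.nodup_iff.2 hl.2⟩, hperm, ?_, ?_, hadj⟩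
  · rw [hlast₁, List.head?_reverse, hlast₂, List.getLast?_reverse]
    exact hc.2.2
  · rw [Option.mem_def] at hx₁
    simp [hx₁]
  · rw [Option.mem_def] at hy₂
    simp [List.getLast?_append, hy₂]

/-- A closed path through at least three vertices is a Hamilton cycle if it visits everything. -/
lemma IsPathList.isHamiltonian {l : List V} {x y : V} (hl : G.IsPathList l)
    (hx : x ∈ l.head?) (hy : y ∈ l.getLast?) (hxy : G.Adj x y)
    (hcard : 3 ≤ Fintype.card V) (hall : ∀ v, v ∈ l) : G.IsHamiltonian := by
  intro _
  have hne : l ≠ [] := List.ne_nil_of_mem (hall x)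
  have hlen : l.length = Fintype.card V := by
    rw [← List.toFinset_card_of_nodup hl.2, ← Finset.card_univ]
    congr 1
    ext v
    simp [hall v]
  let p := Walk.ofSupport l hne hl.1
  have hsupp : p.support = l := Walk.support_ofSupport hne hl.1
  have hpl : p.length + 1 = l.length := by simpa [hsupp] using p.length_support.symm
  have hp : p.IsPath := by rw [Walk.isPath_def, hsupp]; exact hl.2
  have hx' : l.head hne = x := by
    rw [List.head?_eq_some_head hne] at hx; simpa using hx
  have hy' : l.getLast hne = y := by
    rw [List.getLast?_eq_some_getLast hne] at hy; simpa using hy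
  have hadj : G.Adj (l.getLast hne) (l.head hne) := by rw [hx', hy']; exact hxy.symm
  refine ⟨_, Walk.cons hadj p, Walk.isHamiltonianCycle_iff_isCycle_and_length_eq.2
    ⟨(Walk.cons_isCycle_iff p hadj).2 ⟨hp, fun he => ?_⟩, ?_⟩⟩
  -- A path containing an edge between its own ends has length one.
  · have := hp.length_eq_one_of_mem_edges (Sym2.eq_swap ▸ he)
    omega
  · rw [Walk.length_cons]; omega

end SimpleGraph

end LocalRotations

/-! ### Hamiltonicity from joined sets and few rotations -/

section CombinatorialCriterion

namespace SimpleGraph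

variable {V : Type*} [Fintype V] [DecidableEq V] {G : SimpleGraph V}

/-- If `t` rotations of a longest path reach `M` first vertices, then one more rotation reaches
about a quarter of all vertices. -/
lemma JoinsSets.card_lt_of_le_rotationEnds {M : ℕ} (h : G.JoinsSets M) {l : List V}
    (hl : G.IsLongestPathList l) {t : ℕ} (ht : M ≤ (G.rotationEnds l t).card) :
    Fintype.card V < 4 * (G.rotationEnds l (t + 1)).card + 1 + M := by
  have h1 := h.card_univ_le ht
  have h2 := hl.card_externalNeighborhood_le (subset_refl (G.rotationEnds l t))
  have h3 := Finset.card_le_card (rotationEnds_subset_succ (G := G) (l₀ := l) (t := t))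
  omega

/-- The ends and all their neighbors lie on `l`. -/
lemma JoinsSets.card_lt_length_add {M : ℕ} (h : G.JoinsSets M) {l : List V}
    (hl : G.IsLongestPathList l) {t : ℕ} (ht : M ≤ (G.rotationEnds l t).card) :
    Fintype.card V < l.length + M := by
  have h1 := h.card_univ_le ht
  have hd : Disjoint (G.rotationEnds l t) (externalNeighborhood G (G.rotationEnds l t)) :=
    Finset.disjoint_left.2 fun x hx hx' => (mem_externalNeighborhood.1 hx').1 hx
  have h2 : G.rotationEnds l t ∪ externalNeighborhood G (G.rotationEnds l t) ⊆ l.toFinset := by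
    intro v hv
    rw [List.mem_toFinset]
    rcases Finset.mem_union.1 hv with hv | hv
    · obtain ⟨l', hl', hv'⟩ := mem_rotationEnds.1 hv
      exact hl'.perm.mem_iff.1 (List.mem_of_mem_head? hv')
    · obtain ⟨-, u, hu, hadj⟩ := mem_externalNeighborhood.1 hv
      exact hl.mem_of_adj_rotationEnds hu hadj
  have h3 := Finset.card_le_card h2
  rw [Finset.card_union_of_disjoint hd, List.toFinset_card_of_nodup hl.1.2] at h3
  omega

/-- Let any two disjoint sets of `M` vertices be joined by an edge, let `t` rotations of any
longest path reach at least `M` first vertices, let `t` be small compared to `|V| / M`, and let no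
component be smaller than `M`. Then the graph is Hamiltonian. -/
theorem JoinsSets.isHamiltonian {M t : ℕ} (h : G.JoinsSets M) (hM : 1 ≤ M)
    (hends : ∀ l, G.IsLongestPathList l → M ≤ (G.rotationEnds l t).card)
    (hcard : (2 * (t + 1) + 2) * (11 * M + 3) + M ≤ Fintype.card V)
    (hconn : ∀ Z : Finset V, Z.Nonempty → Z.card < M → (externalNeighborhood G Z).Nonempty) :
    G.IsHamiltonian := by
  classical
  obtain ⟨l₀, hl₀⟩ := exists_isLongestPathList G
  -- Two rounds of `t + 1` rotations destroy at most `2 * (t + 1)` blocks; two must survive.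
  set K := 2 * (t + 1) + 2 with hK
  have hKM : K * (11 * M + 3) = 11 * (K * M) + 3 * K := by ring
  have hKM' : M ≤ K * M := Nat.le_mul_of_pos_left M (by omega)
  have hlen := h.card_lt_length_add hl₀ (hends l₀ hl₀)
  obtain ⟨J, hJ, hdisj⟩ := hl₀.1.2.exists_disjoint_infix (k := K) (s := 11 * M + 3) (by omega)
  have hJn : ∀ i, (J i).Nodup := fun i => hl₀.1.2.sublist (hJ i).1.sublist
  have hJne : ∀ i, J i ≠ [] := fun i => List.ne_nil_of_length_pos (by rw [(hJ i).2]; omega)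
  choose D hDJ hDcard hD using fun i => h.exists_expanding_part (hJn i) (hJ i).2.ge
  let bad : Finset V := Finset.univ.biUnion fun i : Fin K =>
    Finset.univ.filter fun a => ∀ v ∈ listInterior (J i) (D i), ¬ G.Adj a v
  have hbad : bad.card ≤ K * M := by
    refine (Finset.card_biUnion_le_card_mul _ _ M fun i _ => ?_).trans (by simp)
    exact (h.card_le_of_no_adj (hDcard i) (by simp)).le
  have hgood : ∀ a, a ∉ bad → ∀ i, ∃ v ∈ listInterior (J i) (D i), G.Adj a v := by
    intro a ha i
    by_contra! hc
    exact ha (Finset.mem_biUnion.2 ⟨i, Finset.mem_univ _, by simpa using hc⟩)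
  have hmany : ∀ l, G.IsLongestPathList l → ∃ a ∈ G.rotationEnds l (t + 1), a ∉ bad := by
    intro l hl
    have h1 := h.card_lt_of_le_rotationEnds hl (hends l hl)
    exact Finset.exists_mem_notMem_of_card_lt_card (by omega)
  obtain ⟨a, ha, ha'⟩ := hmany l₀ hl₀
  obtain ⟨l₁, hl₁, hal₁⟩ := mem_rotationEnds.1 ha
  -- After reversal `a` is last, so it stays fixed while the other end is rotated.
  have hl₁max : G.IsLongestPathList l₁.reverse :=
    hl₀.of_perm (hl₁.isPathList hl₀.1).reverse ((List.reverse_perm _).trans hl₁.perm)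
  obtain ⟨b, hb, hb'⟩ := hmany _ hl₁max
  obtain ⟨l, hl, hbl⟩ := mem_rotationEnds.1 hb
  have hlpath := hl.isPathList hl₁max.1
  have hal : a ∈ l.getLast? := by
    rw [hl.getLast?, List.getLast?_reverse]; exact hal₁
  obtain ⟨B₁, hB₁, hseg₁⟩ := hl₁.exists_destroyed hdisj
  obtain ⟨B₂, hB₂, hseg₂⟩ := hl.exists_destroyed hdisj
  have hseg : ∀ i, i ∈ (B₁ ∪ B₂)ᶜ → (J i).Segment l := by
    intro i hi
    rw [Finset.mem_compl, Finset.mem_union, not_or] at hi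
    exact hseg₂ i hi.2 (hseg₁ i hi.1 (.inl (hJ i).1)).reverse
  have hcompl : 1 < ((B₁ ∪ B₂)ᶜ).card := by
    have h1 := Finset.card_union_le B₁ B₂
    rw [Finset.card_compl, Fintype.card_fin]
    omega
  obtain ⟨i, hi, j, hj, hij⟩ := Finset.one_lt_card.1 hcompl
  obtain ⟨p, q, rfl, hpq⟩ := List.Segment.exists_append (hJne i) (hJne j) (hdisj i j hij)
    (hseg i hi) (hseg j hj)
  have hclosed : ∃ l x y, G.IsPathList l ∧ l.Perm (p ++ q) ∧ x ∈ l.head? ∧ y ∈ l.getLast? ∧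
      G.Adj x y := by
    rcases hpq with ⟨hi', hj'⟩ | ⟨hj', hi'⟩
    · exact h.exists_closed_path (hJn i) (hJn j) (hDJ i) (hDJ j) (hD i) (hD j) (hdisj i j hij)
        hlpath hi' hj' hbl hal (hgood b hb' i) (hgood a ha' j)
    · exact h.exists_closed_path (hJn j) (hJn i) (hDJ j) (hDJ i) (hD j) (hD i)
        (hdisj j i hij.symm) hlpath hj' hi' hbl hal (hgood b hb' j) (hgood a ha' i)
  obtain ⟨c, x, y, hc, hcperm, hx, hy, hxy⟩ := hclosed
  have hcmax : G.IsLongestPathList c := hl₁max.of_perm hc (hcperm.trans hl.perm)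
  refine hc.isHamiltonian hx hy hxy (by omega) fun v => ?_
  -- The missed vertices are fewer than `M`, so one of them, `u`, is adjacent to some `w` on the
  -- cycle. Opened at `w`, the cycle extends to `u`.
  by_contra hv
  have hZ := Finset.card_compl c.toFinset
  rw [List.toFinset_card_of_nodup hc.2] at hZ
  have hlen' := h.card_lt_length_add hcmax (hends c hcmax)
  obtain ⟨w, hw⟩ := hconn c.toFinsetᶜ ⟨v, by simpa using hv⟩ (by omega)
  obtain ⟨hwc, u, hu, huw⟩ := mem_externalNeighborhood.1 hw
  simp only [Finset.mem_compl, List.mem_toFinset, not_not] at hwc hu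
  obtain ⟨c', hc', hperm', hw'⟩ := hc.exists_rotate hx hy hxy hwc
  exact hu (hperm'.mem_iff.1 ((hcmax.of_perm hc' hperm').mem_of_adj_head hw' huw.symm))

end SimpleGraph

end CombinatorialCriterion

/-! ### Numerical estimates -/

section Parameters

lemma Real.one_le_log_of_twelve_le {d : ℝ} (hd : 12 ≤ d) : 1 ≤ Real.log d := by
  rw [Real.le_log_iff_exp_le (by linarith)]
  linarith [Real.exp_one_lt_d9]

/-- The numerical relations between the number of vertices, the expansion factor, the thresholds
for small and large sets, and the number of rotations. -/
lemma expansion_parameters {n : ℕ} {d : ℝ} (hn : 1035 * Real.log n ≤ √n) (hd : 12 ≤ d)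
    (hdn : d ≤ √n) :
    1 ≤ ⌈n * Real.log d / (1035 * Real.log n)⌉₊ ∧
    (2 * (⌈2 * (Real.log n / Real.log d)⌉₊ + 1 + 1) + 2) *
      (11 * ⌈n * Real.log d / (1035 * Real.log n)⌉₊ + 3) +
      ⌈n * Real.log d / (1035 * Real.log n)⌉₊ ≤ n ∧
    (n : ℝ) ≤ √d ^ ⌈2 * (Real.log n / Real.log d)⌉₊ ∧
    n * Real.log d / (d * Real.log n) < n ∧
    3 * (⌈n * Real.log d / (1035 * Real.log n)⌉₊ : ℝ) + 1 ≤
      d * ⌊n * Real.log d / (d * Real.log n)⌋₊ := by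
  have hsq : √(n : ℝ) * √n = n := Real.mul_self_sqrt (Nat.cast_nonneg n)
  have hn0 : (0 : ℝ) < n := by nlinarith
  have hl := Real.one_le_log_of_twelve_le hd
  have hl2 : 2 * Real.log d ≤ Real.log n := by
    have := Real.log_le_log (by linarith) hdn
    rw [Real.log_sqrt hn0.le] at this
    linarith
  set L := Real.log n
  set r := L / Real.log d with hr
  have hr2 : 2 ≤ r := by rw [hr, le_div_iff₀ (by linarith)]; exact hl2
  have hrL : r ≤ L := div_le_self (by linarith) hl
  have hLr : L = r * Real.log d := by rw [hr]; field_simp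
  have hm : n * Real.log d / (1035 * L) = n / (1035 * r) := by
    rw [hLr]; field_simp
  have hk : n * Real.log d / (d * L) = n / (d * r) := by
    rw [hLr]; field_simp
  rw [hm, hk]
  set m : ℝ := n / (1035 * r) with hm'
  set k : ℝ := n / (d * r) with hk'
  have hmr : m * r = n / 1035 := by rw [hm']; field_simp
  have hdk : d * k = 1035 * m := by rw [hm', hk']; field_simp
  have hk1035 : 1035 ≤ k := by
    rw [hk', le_div_iff₀ (by positivity)]
    calc 1035 * (d * r) ≤ √n * (1035 * L) := by nlinarith
      _ ≤ √n * √n := by gcongr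
      _ = n := hsq
  have hm12 : 12 ≤ m := by nlinarith
  have hmn : m ≤ n / 2070 := by nlinarith
  have hLn : 1035 * L ≤ n := by nlinarith
  have hM1 : m ≤ ⌈m⌉₊ := Nat.le_ceil m
  have hM2 : (⌈m⌉₊ : ℝ) < m + 1 := Nat.ceil_lt_add_one (by linarith)
  have ht1 : 2 * r ≤ ⌈2 * r⌉₊ := Nat.le_ceil _
  have ht2 : (⌈2 * r⌉₊ : ℝ) < 2 * r + 1 := Nat.ceil_lt_add_one (by linarith)
  have hf : k - 1 < ⌊k⌋₊ := Nat.sub_one_lt_floor k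
  refine ⟨?_, ?_, ?_, ?_, ?_⟩
  · exact Nat.one_le_ceil_iff.2 (by linarith)
  · rify
    -- The first factor is at most `4 r + 8 ≤ 8 r` because `2 ≤ r`.
    have h1 : (2 * ((⌈2 * r⌉₊ : ℝ) + 1 + 1) + 2) * (11 * ⌈m⌉₊ + 3) ≤
        (8 * r) * (11 * (m + 1) + 3) := by
      gcongr
      linarith
    have h2 : (8 * r) * (11 * (m + 1) + 3) = 88 * (m * r) + 112 * r := by ring
    rw [hmr] at h2
    linarith
  · have hsd : 0 < √d := Real.sqrt_pos.2 (by linarith)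
    rw [← Real.log_le_log_iff hn0 (by positivity), Real.log_pow, Real.log_sqrt (by linarith)]
    change L ≤ _
    nlinarith
  · rw [hk']
    exact div_lt_self hn0 (by nlinarith)
  -- From `1035 ≤ k` and `d * k = 1035 * m` follows `d ≤ m`, so `d * (k - 1) ≥ 1034 * m`.
  · have : d * (k - 1) ≤ d * ⌊k⌋₊ := by gcongr
    nlinarith

end Parameters

/-! ### Growth of the set of ends under expansion -/

section Expansion

variable {V : Type*} [Fintype V] {G : SimpleGraph V} {d k : ℝ}

/-- If sets of size at most `k` expand by the factor `d`, then each larger set contains one with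
`d ⌊k⌋` neighbors. -/
lemma exists_subset_le_card_externalNeighborhood (hk : 0 ≤ k)
    (hG : ∀ S : Finset V, (S.card : ℝ) ≤ k → d * S.card ≤ (externalNeighborhood G S).card)
    {A : Finset V} (hA : k ≤ A.card) :
    ∃ S ⊆ A, d * ⌊k⌋₊ ≤ (externalNeighborhood G S).card := by
  obtain ⟨S, hS, hc⟩ := Finset.exists_subset_card_eq (Nat.floor_le_of_le hA)
  exact ⟨S, hS, hc ▸ hG S (hc ▸ Nat.floor_le hk)⟩

/-- If small sets expand, a small nonempty set has an external neighbor. -/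
lemma nonempty_externalNeighborhood_of_card_lt (hk : 0 ≤ k) (hd : 0 < d)
    (hG : ∀ S : Finset V, (S.card : ℝ) ≤ k → d * S.card ≤ (externalNeighborhood G S).card)
    {Z : Finset V} (hZ : Z.Nonempty) (hcard : (Z.card : ℝ) < d * ⌊k⌋₊) :
    (externalNeighborhood G Z).Nonempty := by
  by_contra! hempty
  rcases le_total (Z.card : ℝ) k with h | h
  · have h1 := hG Z h
    have h2 : (0 : ℝ) < Z.card := by exact_mod_cast hZ.card_pos
    rw [hempty] at h1
    simp only [Finset.card_empty, Nat.cast_zero] at h1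
    nlinarith
  -- If `Z` has no external neighbors, those of `S ⊆ Z` lie in `Z`, which is then too large.
  · obtain ⟨S, hS, hle⟩ := exists_subset_le_card_externalNeighborhood hk hG h
    have hsub : externalNeighborhood G S ⊆ Z := by
      intro v hv
      by_contra hvZ
      obtain ⟨-, u, hu, hadj⟩ := SimpleGraph.mem_externalNeighborhood.1 hv
      have : v ∈ externalNeighborhood G Z :=
        SimpleGraph.mem_externalNeighborhood.2 ⟨hvZ, u, hS hu, hadj⟩
      simp [hempty] at this
    have : ((externalNeighborhood G S).card : ℝ) ≤ Z.card := by
      exact_mod_cast Finset.card_le_card hsub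
    linarith

/-- If small sets expand by a factor `d ≥ 12`, the number of first vertices of rotated longest
paths grows by the factor `√d` per rotation until it exceeds `k`, and then jumps to `d k / 3`. -/
lemma SimpleGraph.IsLongestPathList.le_card_rotationEnds [Nonempty V] (hk : 0 ≤ k) (hd : 12 ≤ d)
    (hG : ∀ S : Finset V, (S.card : ℝ) ≤ k → d * S.card ≤ (externalNeighborhood G S).card)
    {t : ℕ} (ht : k < √d ^ t) {l : List V} (hl : G.IsLongestPathList l) :
    d * ⌊k⌋₊ ≤ 3 * (G.rotationEnds l (t + 1)).card + 1 := by
  have hne : l ≠ [] := by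
    rintro rfl
    have := hl.2 [Classical.arbitrary V] ⟨.singleton _, List.nodup_singleton _⟩
    simp at this
  have hstep : ∀ s, ∀ S ⊆ G.rotationEnds l s, ((externalNeighborhood G S).card : ℝ) ≤
      3 * (G.rotationEnds l (s + 1)).card + 1 := by
    intro s S hS
    exact_mod_cast hl.card_externalNeighborhood_le hS
  -- This is where `12 ≤ d` enters: `d x ≤ 3 y + 1` and `1 ≤ x` then give `√d x ≤ y`.
  have hsqrt : 3 * √d ≤ d - 1 := by
    have h1 : √d * √d = d := Real.mul_self_sqrt (by linarith)
    have h2 : 3.4 ≤ √d := Real.le_sqrt_of_sq_le (by norm_num; linarith)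
    nlinarith
  have hgrow : ∀ s, ((G.rotationEnds l s).card : ℝ) ≤ k →
      √d ^ s ≤ (G.rotationEnds l s).card := by
    intro s
    induction s with
    | zero =>
      intro _
      have : 0 < (G.rotationEnds l 0).card := Finset.card_pos.2
        ⟨l.head hne, SimpleGraph.mem_rotationEnds.2 ⟨l, .refl 0, List.head?_eq_some_head hne⟩⟩
      rw [pow_zero]
      exact_mod_cast this
    | succ s ih =>
      intro hs
      have hmono : ((G.rotationEnds l s).card : ℝ) ≤ (G.rotationEnds l (s + 1)).card := by
        exact_mod_cast Finset.card_le_card SimpleGraph.rotationEnds_subset_succ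
      have h1 := ih (hmono.trans hs)
      have h2 := hG _ (hmono.trans hs)
      have h3 := hstep s _ subset_rfl
      have h4 : 1 ≤ √d ^ s := one_le_pow₀ (Real.one_le_sqrt.2 (by linarith))
      rw [pow_succ]
      nlinarith [Real.sqrt_nonneg d]
  rcases le_total ((G.rotationEnds l t).card : ℝ) k with h | h
  · linarith [hgrow t h]
  · obtain ⟨S, hS, hle⟩ := exists_subset_le_card_externalNeighborhood hk hG h
    exact hle.trans (hstep t S hS)

end Expansion

/-! ### The main theorem -/

theorem theorem2 :
    ∃ n₀ : ℕ, ∀ (V : Type*) [Fintype V] [DecidableEq V] (G : SimpleGraph V) (d : ℝ),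
      n₀ ≤ Fintype.card V →
      12 ≤ d → d ≤ Real.sqrt (Fintype.card V : ℝ) →
      SmallSetsExpand G d → LargeSetsJoined G d →
      G.IsHamiltonian := by
  -- The only condition that determines `n₀`.
  have hlog : ∀ᶠ n : ℕ in Filter.atTop, 1035 * Real.log n ≤ √(n : ℝ) := by
    have h := (isLittleO_log_rpow_atTop (r := 1 / 2) (by norm_num)).bound
      (c := 1 / 1035) (by norm_num)
    filter_upwards [tendsto_natCast_atTop_atTop.eventually h] with n hn
    rw [Real.norm_eq_abs, Real.norm_of_nonneg (by positivity), ← Real.sqrt_eq_rpow] at hn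
    linarith [le_abs_self (Real.log n)]
  obtain ⟨n₀, hn₀⟩ := Filter.eventually_atTop.1 hlog
  refine ⟨n₀, fun V _ _ G d hn hd hdn hsmall hlarge => ?_⟩
  obtain ⟨hM, hcard, ht, hk, hfloor⟩ := expansion_parameters (hn₀ _ hn) hd hdn
  have hl := Real.one_le_log_of_twelve_le hd
  have hk0 : 0 ≤ (Fintype.card V : ℝ) * Real.log d / (d * Real.log (Fintype.card V : ℝ)) :=
    div_nonneg (by positivity) (mul_nonneg (by linarith) (Real.log_natCast_nonneg _))
  have : Nonempty V := Fintype.card_pos_iff.1 (by omega)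
  refine SimpleGraph.JoinsSets.isHamiltonian (fun A B hAB hA hB =>
    hlarge A B hAB (Nat.ceil_le.1 hA) (Nat.ceil_le.1 hB)) hM (fun l hlong => ?_) hcard
    (fun Z hZ hZM => ?_)
  -- Combined with `hfloor`, this gives `3 M + 1 ≤ d ⌊k⌋ ≤ 3 |R| + 1` for the set `R` of ends.
  · have := hlong.le_card_rotationEnds hk0 hd hsmall (hk.trans_le ht)
    rify
    linarith
  · refine nonempty_externalNeighborhood_of_card_lt hk0 (by linarith) hsmall hZ ?_
    rify at hZM
    linarith
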